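/- Let $(B_t)_{t\ge 0}$ be a standard complex-valued Brownian motion starting at $0$, that is, $\operatorname{Re}B$ and $\operatorname{Im}B$ are independent standard real Brownian motions started at $0$ with almost surely continuous paths. Let $T=\inf\{t\ge 0 : B_t\notin S\}$ be its exit time from the strip $S=\{z\in\mathbb{C} : -1<\operatorname{Re}z<1\}$. Then $T<\infty$ almost surely, and $\operatorname{Im}(B_T)$ has the hyperbolic secant law, that is, the probability law on $\mathbb{R}$ with density $$y\mapsto \tfrac12\operatorname{sech}\!\left(\tfrac{\pi}{2}y\right)$$ with respect to Lebesgue measure, where $\operatorname{sech}x=1/\cosh x$. -/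

import Mathlib

open MeasureTheory ProbabilityTheory
open scoped NNReal ENNReal

/-- `B` is a (standard) complex-valued Brownian motion started at `z` on `(Ω, P)`: the real and
imaginary parts of `B - z` are independent (as processes) standard real Brownian motions, which
start at `0` and have continuous paths almost surely. -/
structure IsComplexBrownian {Ω : Type*} [MeasurableSpace Ω] (B : ℝ≥0 → Ω → ℂ) (z : ℂ)
    (P : Measure Ω) : Prop where
  re_isBrownian : IsBrownianReal (fun t ω => (B t ω).re - z.re) P
  im_isBrownian : IsBrownianReal (fun t ω => (B t ω).im - z.im) P
  indep : IndepFun (fun ω t => (B t ω).re - z.re) (fun ω t => (B t ω).im - z.im) P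

/-- The exit time `inf {t ≥ 0 : B t ∉ U}` of the process `B` from the set `U`, with value `⊤` on
the paths that never leave `U`. -/
noncomputable def exitTime {Ω : Type*} (B : ℝ≥0 → Ω → ℂ) (U : Set ℂ) : Ω → WithTop ℝ≥0 :=
  hittingAfter B Uᶜ 0

/-- The open vertical strip `{-1 < Re z < 1}`. -/
def verticalStrip : Set ℂ := {z : ℂ | -1 < z.re ∧ z.re < 1}

/-- The hyperbolic secant. -/
noncomputable def sech (x : ℝ) : ℝ := 1 / Real.cosh x

/-- The hyperbolic secant law on `ℝ`, with Lebesgue density `y ↦ sech (π y / 2) / 2`. -/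
noncomputable def hyperbolicSecantLaw : Measure ℝ :=
  volume.withDensity fun y => ENNReal.ofReal (sech (Real.pi / 2 * y) / 2)

/-!
Write `X` and `Y` for the real and imaginary parts of the Brownian motion, so that its exit time
from the strip is the exit time `T` of `X` from `(-1, 1)`. The law of `Y_T` is identified through
its characteristic function.

For a real number `b` and `a = ± b`, the process `exp (a X + i b Y)` (`planarExp`) is a martingale:
the exponential factors `exp (a² t / 2)` and `exp (-b² t / 2)` produced by the two independent
components cancel. It is bounded up to time `T`, where `|X| ≤ 1`, so its expectation at time `T` is
its initial value `1` (`integral_planarExp_exit`). Averaging over the two signs of `a` gives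
`cosh b * E[exp (i b Y_T)] = 1`, because `|X_T| = 1` (`integral_cexp_exit`). On the other hand
`1 / cosh b` is the Fourier transform of the hyperbolic secant density
(`charFun_hyperbolicSecantLaw`): a sigmoid substitution turns the Fourier integral into a beta
integral, to which the reflection formula of the Gamma function applies.

Optional stopping in continuous time is obtained from an elementary discrete version. Since the
process is only almost everywhere measurable at each time, no filtration is introduced: on a grid of
times the stopped value is a telescoping sum of increments, each multiplied by the indicator of an
event in the past of `X`, and the expectations of these terms are computed from the independence of
the increments of `X` and the independence of `X` and `Y`. For `r < 1` the hitting times of the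
*open* set `{|X| > r}` along finer and finer grids converge to the hitting time in continuous time,
and a uniform `L²` bound takes care of the overshoot. Letting `r` increase to `1`, and then the
deadline to infinity, dominated convergence suffices. That `T` is finite follows from
`P (|X_n| < 1) → 0`.
-/

open Filter Topology

/-! ### The Fourier transform of the hyperbolic secant -/

/-- The integrand of `Complex.betaIntegral (1 / 2 + i s) (1 / 2 - i s)` after the substitution
`x = sigmoid (π y)`, Jacobian included. -/
lemma beta_density_comp_sigmoid (s y : ℝ) :
    |Real.pi * (Real.sigmoid (Real.pi * y) * (1 - Real.sigmoid (Real.pi * y)))| •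
      ((Real.sigmoid (Real.pi * y) : ℂ) ^ (1 / 2 + s * Complex.I - 1 : ℂ) *
        (1 - (Real.sigmoid (Real.pi * y) : ℂ)) ^ (1 / 2 - s * Complex.I - 1 : ℂ)) =
      Real.pi * ((sech (Real.pi / 2 * y) / 2 : ℝ) *
        Complex.exp (s * Real.pi * y * Complex.I)) := by
  have hx0 := Real.sigmoid_pos (Real.pi * y)
  have hx1 : 0 < 1 - Real.sigmoid (Real.pi * y) := sub_pos.2 (Real.sigmoid_lt_one _)
  have e1 : Real.exp (Real.pi * y) = Real.exp (Real.pi / 2 * y) ^ 2 := by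
    rw [← Real.exp_nat_mul]; congr 1; push_cast; ring
  have e2 : Real.exp (-(Real.pi / 2 * y)) = (Real.exp (Real.pi / 2 * y))⁻¹ := Real.exp_neg _
  have hE := Real.exp_pos (Real.pi / 2 * y)
  -- Both factors are written as exponentials with real exponents, for which complex powers are
  -- exponentials as well.
  have p1 : Real.sigmoid (Real.pi * y) =
      Real.exp (Real.pi / 2 * y - Real.log (2 * Real.cosh (Real.pi / 2 * y))) := by
    rw [Real.exp_sub, Real.exp_log (by have := Real.cosh_pos (Real.pi / 2 * y); positivity),
      Real.cosh_eq, Real.sigmoid_def, Real.exp_neg, e1, e2]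
    field_simp
  have p2 : 1 - Real.sigmoid (Real.pi * y) =
      Real.exp (-(Real.pi / 2 * y) - Real.log (2 * Real.cosh (Real.pi / 2 * y))) := by
    rw [Real.exp_sub, Real.exp_log (by have := Real.cosh_pos (Real.pi / 2 * y); positivity),
      Real.cosh_eq, Real.sigmoid_def, Real.exp_neg, e1, e2]
    field_simp
    ring
  have hs : sech (Real.pi / 2 * y) / 2 =
      Real.exp (-Real.log (2 * Real.cosh (Real.pi / 2 * y))) := by
    rw [Real.exp_neg, Real.exp_log (by have := Real.cosh_pos (Real.pi / 2 * y); positivity), sech]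
    field_simp
  have hcpow (u : ℝ) (w : ℂ) : ((Real.exp u : ℝ) : ℂ) ^ w = Complex.exp (u * w) := by
    rw [Complex.cpow_def_of_ne_zero (by exact_mod_cast (Real.exp_pos u).ne'),
      ← Complex.ofReal_log (Real.exp_pos u).le, Real.log_exp]
  have hcast : (1 - (Real.sigmoid (Real.pi * y) : ℂ)) = (1 - Real.sigmoid (Real.pi * y) : ℝ) := by
    push_cast; rfl
  rw [abs_of_pos (by positivity), hcast, p2, p1, hs, hcpow, hcpow, Complex.real_smul]
  push_cast
  rw [mul_assoc, ← Complex.exp_add, ← Complex.exp_add, ← Complex.exp_add, ← Complex.exp_add]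
  congr 2
  ring

lemma hasDerivAt_sigmoid_pi_mul (y : ℝ) :
    HasDerivAt (fun y => Real.sigmoid (Real.pi * y))
      (Real.pi * (Real.sigmoid (Real.pi * y) * (1 - Real.sigmoid (Real.pi * y)))) y := by
  have h := (Real.hasDerivAt_sigmoid (Real.pi * y)).comp y ((hasDerivAt_id y).const_mul Real.pi)
  simpa [Function.comp_def, mul_comm] using h

lemma range_sigmoid_pi_mul :
    (fun y => Real.sigmoid (Real.pi * y)) '' Set.univ = Set.Ioo 0 1 := by
  rw [Set.image_univ, ← Real.range_sigmoid]
  exact (Equiv.mulLeft₀ Real.pi Real.pi_ne_zero).surjective.range_comp Real.sigmoid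

lemma injective_sigmoid_pi_mul : Function.Injective fun y => Real.sigmoid (Real.pi * y) :=
  Real.sigmoid_injective.comp (mul_right_injective₀ Real.pi_ne_zero)

lemma integrable_sech : Integrable fun y : ℝ => sech (Real.pi / 2 * y) / 2 := by
  have h := Complex.betaIntegral_convergent (u := 1 / 2 + (0 : ℝ) * Complex.I)
    (v := 1 / 2 - (0 : ℝ) * Complex.I) (by simp) (by simp)
  rw [intervalIntegrable_iff_integrableOn_Ioo_of_le zero_le_one, ← range_sigmoid_pi_mul,
    integrableOn_image_iff_integrableOn_abs_deriv_smul MeasurableSet.univ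
      (fun y _ => (hasDerivAt_sigmoid_pi_mul y).hasDerivWithinAt)
      injective_sigmoid_pi_mul.injOn] at h
  simp_rw [beta_density_comp_sigmoid] at h
  rw [integrableOn_univ] at h
  have h2 := (h.const_mul ((Real.pi : ℂ)⁻¹)).re
  refine h2.congr (ae_of_all _ fun y => ?_)
  have : (Real.pi : ℂ) ≠ 0 := by exact_mod_cast Real.pi_ne_zero
  simp only
  rw [inv_mul_cancel_left₀ this]
  simp only [Complex.ofReal_zero, zero_mul, Complex.exp_zero, mul_one]
  exact RCLike.ofReal_re (K := ℂ) _

/-- The Fourier transform of the hyperbolic secant density. The substitution `x = 1 / (1 + e^{-πy})`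
turns the integral into the beta integral `Β(1/2 + is, 1/2 - is)` with `s = t / π`, which the
reflection formula of the Gamma function evaluates. -/
lemma integral_sech_mul_cexp (t : ℝ) :
    ∫ y : ℝ, ((sech (Real.pi / 2 * y) / 2 : ℝ) : ℂ) * Complex.exp (t * y * Complex.I) =
      1 / Real.cosh t := by
  have hpi : (Real.pi : ℂ) ≠ 0 := by exact_mod_cast Real.pi_ne_zero
  set s : ℝ := t / Real.pi with hs
  have hB := Complex.Gamma_mul_Gamma_eq_betaIntegral (s := 1 / 2 + s * Complex.I)
    (t := 1 / 2 - s * Complex.I) (by simp) (by simp)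
  have h1 : (1 / 2 + s * Complex.I + (1 / 2 - s * Complex.I) : ℂ) = 1 := by ring
  have h2 : (1 / 2 - s * Complex.I : ℂ) = 1 - (1 / 2 + s * Complex.I) := by ring
  have h3 : (Real.pi * (1 / 2 + s * Complex.I) : ℂ) = t * Complex.I + Real.pi / 2 := by
    rw [hs]; push_cast; field_simp; ring
  rw [h1, Complex.Gamma_one, one_mul] at hB
  nth_rw 1 [h2] at hB
  rw [Complex.Gamma_mul_Gamma_one_sub, h3, Complex.sin_add_pi_div_two, Complex.cos_mul_I,
    Complex.betaIntegral, intervalIntegral.integral_of_le zero_le_one, integral_Ioc_eq_integral_Ioo,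
    ← range_sigmoid_pi_mul, integral_image_eq_integral_abs_deriv_smul MeasurableSet.univ
      (fun y _ => (hasDerivAt_sigmoid_pi_mul y).hasDerivWithinAt)
      injective_sigmoid_pi_mul.injOn] at hB
  simp_rw [beta_density_comp_sigmoid] at hB
  rw [integral_const_mul, setIntegral_univ, div_eq_mul_one_div] at hB
  have hst : (s : ℂ) * Real.pi = t := by rw [hs]; push_cast; field_simp
  rw [hst] at hB
  rw [Complex.ofReal_cosh]
  exact (mul_left_cancel₀ hpi hB).symm

instance : IsFiniteMeasure hyperbolicSecantLaw :=
  isFiniteMeasure_withDensity_ofReal integrable_sech.2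

lemma charFun_hyperbolicSecantLaw (t : ℝ) :
    charFun hyperbolicSecantLaw t = 1 / Real.cosh t := by
  have hpos (y : ℝ) : 0 ≤ sech (Real.pi / 2 * y) / 2 := by
    have := Real.cosh_pos (Real.pi / 2 * y)
    unfold sech
    positivity
  rw [charFun_apply_real, hyperbolicSecantLaw, integral_withDensity_eq_integral_toReal_smul₀
    (integrable_sech.aemeasurable.ennreal_ofReal) (ae_of_all _ fun _ => ENNReal.ofReal_lt_top),
    ← integral_sech_mul_cexp]
  refine integral_congr_ae (ae_of_all _ fun y => ?_)
  simp only [ENNReal.toReal_ofReal (hpos y), Complex.real_smul]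

/-! ### Hitting times of real paths -/

/-- The infimum of the indices at which `x` lies in `s`, or the deadline `N` if that comes first.
Inserting `N` into the set keeps the infimum away from the empty set. In continuous time the path
need not lie in `s` at the infimum: for an open `s` it usually does not. -/
noncomputable def cappedHittingTime {ι : Type*} [InfSet ι] (x : ι → ℝ) (s : Set ℝ) (N : ι) : ι :=
  sInf (insert N (x ⁻¹' s))

section cappedHittingTime
variable {ι : Type*} [ConditionallyCompleteLinearOrderBot ι] {x : ι → ℝ} {s s' : Set ℝ} {N t : ι}

lemma cappedHittingTime_le_deadline : cappedHittingTime x s N ≤ N :=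
  csInf_le' (Set.mem_insert _ _)

lemma cappedHittingTime_le (h : x t ∈ s) : cappedHittingTime x s N ≤ t :=
  csInf_le' (Set.mem_insert_of_mem _ h)

lemma cappedHittingTime_lt_iff :
    cappedHittingTime x s N < t ↔ N < t ∨ ∃ u < t, x u ∈ s := by
  rw [cappedHittingTime, csInf_lt_iff (OrderBot.bddBelow _) (Set.insert_nonempty _ _)]
  simp only [Set.mem_insert_iff, Set.mem_preimage]
  constructor
  · rintro ⟨u, rfl | h, hu⟩
    exacts [Or.inl hu, Or.inr ⟨u, hu, h⟩]
  · rintro (h | ⟨u, hu, h⟩)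
    exacts [⟨N, Or.inl rfl, h⟩, ⟨u, Or.inr h, hu⟩]

lemma le_cappedHittingTime_iff :
    t ≤ cappedHittingTime x s N ↔ t ≤ N ∧ ∀ u < t, x u ∉ s := by
  rw [← not_lt, cappedHittingTime_lt_iff]
  simp

lemma notMem_of_lt_cappedHittingTime (h : t < cappedHittingTime x s N) : x t ∉ s :=
  fun hx => (cappedHittingTime_le hx).not_gt h

lemma cappedHittingTime_anti (h : s ⊆ s') :
    cappedHittingTime x s' N ≤ cappedHittingTime x s N :=
  le_cappedHittingTime_iff.2 ⟨cappedHittingTime_le_deadline,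
    fun _ hu hx => notMem_of_lt_cappedHittingTime hu (h hx)⟩

lemma lt_cappedHittingTime_nat_iff {x : ℕ → ℝ} {s : Set ℝ} {N k : ℕ} (hk : k < N) :
    k < cappedHittingTime x s N ↔ ∀ j ≤ k, x j ∉ s := by
  rw [← Nat.succ_le_iff, le_cappedHittingTime_iff]
  simp [hk]

end cappedHittingTime

open scoped Classical in
/-- The indicator function of the event that the sequence `x` avoids `s` up to index `k`. -/
noncomputable def avoidIndicator (s : Set ℝ) (k : ℕ) (x : ℕ → ℝ) : ℝ :=
  if ∀ j ≤ k, x j ∉ s then 1 else 0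

lemma avoidIndicator_nonneg (s : Set ℝ) (k : ℕ) (x : ℕ → ℝ) : 0 ≤ avoidIndicator s k x := by
  unfold avoidIndicator; split_ifs <;> norm_num

lemma avoidIndicator_le_one (s : Set ℝ) (k : ℕ) (x : ℕ → ℝ) : avoidIndicator s k x ≤ 1 := by
  unfold avoidIndicator; split_ifs <;> norm_num

lemma avoidIndicator_min (s : Set ℝ) (k : ℕ) (x : ℕ → ℝ) :
    avoidIndicator s k (fun j => x (min j k)) = avoidIndicator s k x := by
  unfold avoidIndicator
  congr 1
  exact propext (forall₂_congr fun j hj => by simp only [min_eq_left hj])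

lemma measurable_avoidIndicator {s : Set ℝ} (hs : MeasurableSet s) (k : ℕ) :
    Measurable (avoidIndicator s k) := by
  refine Measurable.ite ?_ measurable_const measurable_const
  have h (j : ℕ) : MeasurableSet {x : ℕ → ℝ | x j ∉ s} :=
    (show Measurable fun x : ℕ → ℝ => x j by fun_prop) hs.compl
  simp only [Set.ofPred_forall]
  exact MeasurableSet.iInter fun j => MeasurableSet.iInter fun _ => h j

/-- Telescoping up to a capped hitting time: the value of `w` at that time is the sum of the
increments that precede it. -/
lemma sum_avoidIndicator_smul_sub {E : Type*} [AddCommGroup E] [Module ℝ E] (x : ℕ → ℝ)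
    (s : Set ℝ) (N : ℕ) (w : ℕ → E) :
    ∑ k ∈ Finset.range N, avoidIndicator s k x • (w (k + 1) - w k) =
      w (cappedHittingTime x s N) - w 0 := by
  classical
  simp only [avoidIndicator, ite_smul, one_smul, zero_smul]
  rw [← Finset.sum_range_sub, ← Finset.sum_filter]
  refine Finset.sum_congr (Finset.ext fun k => ?_) fun _ _ => rfl
  rw [Finset.mem_filter, Finset.mem_range, Finset.mem_range]
  constructor
  · rintro ⟨h, h'⟩
    exact (lt_cappedHittingTime_nat_iff h).2 h'
  · intro h
    have hN := h.trans_le cappedHittingTime_le_deadline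
    exact ⟨hN, (lt_cappedHittingTime_nat_iff hN).1 h⟩

/-- The `k`-th point of the grid of mesh `1 / (n + 1)` in `[0, ∞)`. -/
noncomputable def gridTime (n k : ℕ) : ℝ≥0 := k / (n + 1 : ℕ)

lemma monotone_gridTime (n : ℕ) : Monotone (gridTime n) := fun k l hkl => by
  unfold gridTime
  gcongr

lemma gridTime_mul_succ (n N : ℕ) : gridTime n (N * (n + 1)) = N := by
  unfold gridTime
  push_cast
  field_simp

/-- The hitting times of an open set along the grids of mesh `1 / (n + 1)` converge to the hitting
time in continuous time. -/
lemma tendsto_gridTime_cappedHittingTime {x : ℝ≥0 → ℝ} (hx : Continuous x) {s : Set ℝ}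
    (hs : IsOpen s) (N : ℕ) :
    Tendsto (fun n => gridTime n (cappedHittingTime (fun k => x (gridTime n k)) s (N * (n + 1))))
      atTop (𝓝 (cappedHittingTime x s N)) := by
  refine tendsto_order.2 ⟨fun u hu => Eventually.of_forall fun n => hu.trans_le ?_, fun u hu => ?_⟩
  · have hmem := Nat.sInf_mem
      (Set.insert_nonempty (N * (n + 1)) ((fun k => x (gridTime n k)) ⁻¹' s))
    rcases hmem with h | h
    · have h' : cappedHittingTime (fun k => x (gridTime n k)) s (N * (n + 1)) = N * (n + 1) := h
      rw [h', gridTime_mul_succ]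
      exact cappedHittingTime_le_deadline
    · exact cappedHittingTime_le h
  · rcases cappedHittingTime_lt_iff.1 hu with h | ⟨t, ht, hxt⟩
    · refine Eventually.of_forall fun n => lt_of_le_of_lt ?_ h
      rw [← gridTime_mul_succ n N]
      exact monotone_gridTime n cappedHittingTime_le_deadline
    · -- By openness the path is still in `s` at the first grid point after `t`, on a fine grid.
      have hlim : Tendsto (fun n => gridTime n ⌈(t : ℝ) * (n + 1 : ℕ)⌉₊) atTop (𝓝 t) := by
        rw [← NNReal.tendsto_coe]
        have h := (tendsto_nat_ceil_mul_div_atTop t.2).comp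
          ((tendsto_natCast_atTop_atTop (R := ℝ)).comp (tendsto_add_atTop_nat 1))
        simpa [Function.comp_def, gridTime] using h
      filter_upwards [hlim.eventually_lt_const ht,
        ((hx.tendsto t).comp hlim).eventually (hs.mem_nhds hxt)] with n h1 h2
      exact lt_of_le_of_lt (monotone_gridTime n (cappedHittingTime_le h2)) h1

/-- The exit times from `[-r, r]` increase to the exit time from `(-1, 1)` as `r` increases
to `1`. -/
lemma tendsto_cappedHittingTime_of_tendsto_one {x : ℝ≥0 → ℝ} (hx : Continuous x) (N : ℝ≥0)
    {r : ℕ → ℝ} (hr1 : ∀ m, r m < 1) (hr : Tendsto r atTop (𝓝 1)) :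
    Tendsto (fun m => cappedHittingTime x {y | r m < |y|} N) atTop
      (𝓝 (cappedHittingTime x {y | 1 ≤ |y|} N)) := by
  refine tendsto_order.2 ⟨fun u hu => ?_, fun u hu => Eventually.of_forall fun m =>
    lt_of_le_of_lt (cappedHittingTime_anti fun y hy => (hr1 m).trans_le hy) hu⟩
  obtain ⟨v, huv, hv⟩ := exists_between hu
  obtain ⟨c, hc, hmax⟩ := (isCompact_Icc (a := (0 : ℝ≥0)) (b := v)).exists_isMaxOn
    ⟨0, by simp⟩ hx.abs.continuousOn
  have hc1 : |x c| < 1 :=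
    not_le.1 (notMem_of_lt_cappedHittingTime (s := {y | 1 ≤ |y|}) (hc.2.trans_lt hv))
  filter_upwards [hr.eventually_const_lt hc1] with m hm
  refine huv.trans_le (le_cappedHittingTime_iff.2
    ⟨hv.le.trans cappedHittingTime_le_deadline, fun w hw hxw => ?_⟩)
  exact (hm.trans hxw).not_ge (hmax ⟨zero_le, hw.le⟩)

/-- A continuous path that stays in `[-r, r]` before time `t` is still there at time `t`. -/
lemma abs_le_of_forall_lt {x : ℝ≥0 → ℝ} (hx : Continuous x) {r : ℝ} (h0 : |x 0| ≤ r) {t : ℝ≥0}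
    (h : ∀ u < t, |x u| ≤ r) : |x t| ≤ r := by
  rcases eq_or_ne t 0 with rfl | ht
  · exact h0
  · have hcl : t ∈ closure (Set.Iio t) := by
      rw [closure_Iio' ⟨0, pos_of_ne_zero ht⟩]
      exact Set.mem_Iic.2 le_rfl
    exact closure_minimal (t := {u | |x u| ≤ r}) h
      (isClosed_le hx.abs continuous_const) hcl

lemma abs_cappedHittingTime_le {x : ℝ≥0 → ℝ} (hx : Continuous x) {r : ℝ} (h0 : |x 0| ≤ r)
    {s : Set ℝ} (hs : ∀ y, y ∉ s → |y| ≤ r) (N : ℝ≥0) : |x (cappedHittingTime x s N)| ≤ r :=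
  abs_le_of_forall_lt hx h0 fun _ hu => hs _ (notMem_of_lt_cappedHittingTime hu)

/-- A path that leaves `(-1, 1)` does so at a finite time, at one of the two end points. -/
lemma exists_exit {x : ℝ≥0 → ℝ} (hx : Continuous x) (h0 : |x 0| ≤ 1)
    (h : (x ⁻¹' {y | 1 ≤ |y|}).Nonempty) :
    |x (sInf (x ⁻¹' {y | 1 ≤ |y|}))| = 1 ∧
      ∀ᶠ N : ℕ in atTop,
        cappedHittingTime x {y | 1 ≤ |y|} N = sInf (x ⁻¹' {y | 1 ≤ |y|}) := by
  have hcl : IsClosed (x ⁻¹' {y | 1 ≤ |y|}) :=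
    (isClosed_le continuous_const continuous_abs).preimage hx
  refine ⟨le_antisymm (abs_le_of_forall_lt hx h0 fun u hu => ?_)
    (hcl.csInf_mem h (OrderBot.bddBelow _)), ?_⟩
  · exact (not_le.1 fun hxu => notMem_of_lt_csInf hu (OrderBot.bddBelow _) hxu).le
  · filter_upwards [(tendsto_natCast_atTop_atTop (R := ℝ≥0)).eventually_ge_atTop
      (sInf (x ⁻¹' {y | 1 ≤ |y|}))] with N hN
    rw [cappedHittingTime, csInf_insert (OrderBot.bddBelow _) h]
    exact min_eq_right hN

/-! ### Passage to the limit under an `L²` bound -/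

/-- A sequence that is bounded in `L²` of a finite measure is uniformly integrable, so that almost
everywhere convergence passes to the integrals. -/
lemma tendsto_integral_of_integral_sq_le {Ω E : Type*} [MeasurableSpace Ω] {μ : Measure Ω}
    [IsFiniteMeasure μ] [NormedAddCommGroup E] [NormedSpace ℝ E] {f : ℕ → Ω → E} {g : Ω → E} {C : ℝ}
    (hf : ∀ n, MemLp (f n) 2 μ) (hC : ∀ n, ∫ ω, ‖f n ω‖ ^ 2 ∂μ ≤ C) (hg : Integrable g μ)
    (h : ∀ᵐ ω ∂μ, Tendsto (fun n => f n ω) atTop (𝓝 (g ω))) :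
    Tendsto (fun n => ∫ ω, f n ω ∂μ) atTop (𝓝 (∫ ω, g ω ∂μ)) := by
  have hC0 : 0 ≤ C := (integral_nonneg fun ω => by positivity).trans (hC 0)
  have hnorm (n : ℕ) : eLpNorm (f n) 2 μ ≤ ENNReal.ofReal (√C) := by
    rw [(hf n).eLpNorm_eq_integral_rpow_norm (by simp) (by simp)]
    refine ENNReal.ofReal_le_ofReal ?_
    rw [Real.sqrt_eq_rpow]
    simp only [ENNReal.toReal_ofNat, Real.rpow_ofNat, one_div]
    exact Real.rpow_le_rpow (integral_nonneg fun ω => by positivity) (hC n) (by positivity)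
  -- Cauchy–Schwarz: `∫ₛ ‖f n‖ ≤ √C * √(μ s)`.
  have hUI : UnifIntegrable f 1 μ := by
    intro ε hε
    have hK : 0 < √C + 1 := by positivity
    refine ⟨(ε / (√C + 1)) ^ 2, by positivity, fun n s hs hμs => ?_⟩
    rw [eLpNorm_indicator_eq_eLpNorm_restrict hs]
    have hexp : (1 / (1 : ℝ≥0∞).toReal - 1 / (2 : ℝ≥0∞).toReal) = 1 / 2 := by norm_num
    calc eLpNorm (f n) 1 (μ.restrict s)
        ≤ eLpNorm (f n) 2 (μ.restrict s) * (μ.restrict s) Set.univ ^ (1 / 2 : ℝ) := by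
          rw [← hexp]
          exact eLpNorm_le_eLpNorm_mul_rpow_measure_univ (by norm_num) (hf n).1.restrict
      _ ≤ ENNReal.ofReal (√C) * ENNReal.ofReal ((ε / (√C + 1)) ^ 2) ^ (1 / 2 : ℝ) := by
          gcongr
          · exact (eLpNorm_mono_measure _ Measure.restrict_le_self).trans (hnorm n)
          · rwa [Measure.restrict_apply_univ]
      _ = ENNReal.ofReal (√C * (ε / (√C + 1))) := by
          rw [ENNReal.ofReal_rpow_of_pos (by positivity), ← Real.sqrt_eq_rpow,
            Real.sqrt_sq (by positivity), ENNReal.ofReal_mul (by positivity)]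
      _ ≤ ENNReal.ofReal ε := by
          refine ENNReal.ofReal_le_ofReal ?_
          rw [mul_div_assoc', div_le_iff₀ hK]
          nlinarith [Real.sqrt_nonneg C]
  have hlim := tendsto_Lp_finite_of_tendsto_ae le_rfl ENNReal.one_ne_top
    (fun n => (hf n).1) (memLp_one_iff_integrable.2 hg) hUI h
  exact tendsto_integral_of_L1' g hg.1
    (Eventually.of_forall fun n => memLp_one_iff_integrable.1 ((hf n).mono_exponent (by norm_num)))
    hlim

/-! ### The exponential process along a path -/

section Processes

variable {Ω : Type*} {X Y : ℝ≥0 → Ω → ℝ}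

/-- The process `exp (a X + i b Y)`. For `a ^ 2 = b ^ 2` this is an exponential of a complex linear
function of `X + i Y` or of its conjugate, and it is a martingale if `X` and `Y` are independent
Brownian motions. -/
noncomputable def planarExp (X Y : ℝ≥0 → Ω → ℝ) (a b : ℝ) (t : ℝ≥0) (ω : Ω) : ℂ :=
  Complex.exp (a * X t ω) * Complex.exp (b * Complex.I * Y t ω)

lemma norm_planarExp (a b : ℝ) (t : ℝ≥0) (ω : Ω) :
    ‖planarExp X Y a b t ω‖ = Real.exp (a * X t ω) := by
  have h1 : (b * Complex.I * Y t ω : ℂ) = ((b * Y t ω : ℝ) : ℂ) * Complex.I := by push_cast; ring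
  rw [planarExp, norm_mul, h1, Complex.norm_exp_ofReal_mul_I, mul_one, Complex.norm_exp]
  simp

lemma continuous_planarExp (a b : ℝ) {ω : Ω} (hX : Continuous (X · ω)) (hY : Continuous (Y · ω)) :
    Continuous (planarExp X Y a b · ω) := by
  unfold planarExp
  fun_prop

lemma norm_planarExp_le {a b r : ℝ} {t : ℝ≥0} {ω : Ω} (h : |X t ω| ≤ r) :
    ‖planarExp X Y a b t ω‖ ≤ Real.exp (|a| * r) := by
  rw [norm_planarExp]
  refine Real.exp_le_exp.2 ((le_abs_self _).trans ?_)
  rw [abs_mul]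
  gcongr

/-- The telescoping formula of `sum_avoidIndicator_smul_sub` for a process `Z` stopped when `X`,
observed at the times `t k`, hits `s`. -/
lemma apply_cappedHittingTime_eq {E : Type*} [AddCommGroup E] [Module ℝ E] (Z : ℝ≥0 → Ω → E)
    (s : Set ℝ) (t : ℕ → ℝ≥0) (K : ℕ) (ω : Ω) :
    Z (t (cappedHittingTime (fun k => X (t k) ω) s K)) ω = Z (t 0) ω +
      ∑ k ∈ Finset.range K, (avoidIndicator s k fun j => X (t j) ω) •
        (Z (t (k + 1)) ω - Z (t k) ω) := by
  rw [sum_avoidIndicator_smul_sub (fun k => X (t k) ω) s K (fun k => Z (t k) ω)]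
  abel

lemma tendsto_apply_gridTime_cappedHittingTime {E : Type*} [TopologicalSpace E] {s : Set ℝ}
    {Z : ℝ≥0 → Ω → E} (hs : IsOpen s) (N : ℕ) {ω : Ω} (hX : Continuous (X · ω))
    (hZ : Continuous (Z · ω)) :
    Tendsto (fun n => Z (gridTime n
      (cappedHittingTime (fun k => X (gridTime n k) ω) s (N * (n + 1)))) ω) atTop
      (𝓝 (Z (cappedHittingTime (X · ω) s N) ω)) :=
  (hZ.tendsto _).comp (tendsto_gridTime_cappedHittingTime hX hs N)

lemma tendsto_one_sub_one_div_add_one :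
    Tendsto (fun m : ℕ => 1 - 1 / ((m : ℝ) + 1)) atTop (𝓝 1) := by
  simpa using tendsto_one_div_add_atTop_nhds_zero_nat.const_sub (1 : ℝ)

lemma tendsto_apply_cappedHittingTime_one {E : Type*} [TopologicalSpace E] {Z : ℝ≥0 → Ω → E}
    (N : ℕ) {ω : Ω} (hX : Continuous (X · ω)) (hZ : Continuous (Z · ω)) :
    Tendsto (fun m : ℕ => Z (cappedHittingTime (X · ω) {y | 1 - 1 / ((m : ℝ) + 1) < |y|} N) ω) atTop
      (𝓝 (Z (cappedHittingTime (X · ω) {y | 1 ≤ |y|} N) ω)) :=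
  (hZ.tendsto _).comp (tendsto_cappedHittingTime_of_tendsto_one hX N
    (fun m => sub_lt_self _ (by positivity)) tendsto_one_sub_one_div_add_one)

/-! ### Exponential functionals of Brownian motion -/

variable [MeasurableSpace Ω] {P : Measure Ω}

lemma ProbabilityTheory.IsPreBrownianReal.integral_cexp_mul
    (hX : IsPreBrownianReal X P) (t : ℝ≥0) (c : ℂ) :
    ∫ ω, Complex.exp (c * X t ω) ∂P = Complex.exp (c ^ 2 * t / 2) := by
  have h := complexMGF_gaussianReal (hX.hasLaw_eval t).map_eq c
  rw [complexMGF] at h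
  rw [h]
  congr 1
  push_cast
  ring

lemma ProbabilityTheory.IsPreBrownianReal.integrable_exp_mul
    (hX : IsPreBrownianReal X P) (t : ℝ≥0) (c : ℝ) :
    Integrable (fun ω => Real.exp (c * X t ω)) P := by
  have h := integrable_exp_mul_gaussianReal (μ := 0) (v := t) c
  rw [← (hX.hasLaw_eval t).map_eq] at h
  exact h.comp_aemeasurable (hX.aemeasurable t)

/-- Independence of an increment of Brownian motion from the past, for exponential functions. -/
lemma ProbabilityTheory.IsPreBrownianReal.integral_past_mul_cexp
    (hX : IsPreBrownianReal X P) {ι : Type*}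
    [Countable ι] {u : ι → ℝ≥0} {s t : ℝ≥0} (hst : s ≤ t) (hu : ∀ i, u i ≤ s) {g : (ι → ℝ) → ℂ}
    (hg : Measurable g) (c : ℂ) :
    ∫ ω, g (fun i => X (u i) ω) * Complex.exp (c * ((X t ω - X s ω : ℝ) : ℂ)) ∂P =
      (∫ ω, g (fun i => X (u i) ω) ∂P) * Complex.exp (c ^ 2 * (t - s) / 2) := by
  obtain ⟨h, rfl⟩ := exists_add_of_le hst
  have hind : IndepFun (fun ω i => X (u i) ω) (fun ω => X (s + h) ω - X s ω) P :=
    ((hX.indepFun_shift s).comp (φ := fun f : ℝ≥0 → ℝ => f h)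
      (ψ := fun (f : Set.Iic s → ℝ) i => f ⟨u i, hu i⟩) (by fun_prop) (by fun_prop)).symm
  have hlaw := hX.hasLaw_sub (s + h) s
  rw [hind.integral_fun_comp_mul_comp (f := g) (g := fun x : ℝ => Complex.exp (c * x))
    (aemeasurable_pi_lambda _ fun i => hX.aemeasurable _)
    ((hX.aemeasurable _).sub (hX.aemeasurable _)) hg.aestronglyMeasurable
    (by fun_prop)]
  congr 1
  have h := complexMGF_gaussianReal hlaw.map_eq c
  rw [complexMGF] at h
  simp only [Pi.sub_apply] at h
  rw [h]
  congr 1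
  simp [nndist_eq_nnnorm]
  ring

lemma ProbabilityTheory.IsPreBrownianReal.integral_past_mul_exp
    (hX : IsPreBrownianReal X P) {ι : Type*}
    [Countable ι] {u : ι → ℝ≥0} {s t : ℝ≥0} (hst : s ≤ t) (hu : ∀ i, u i ≤ s) {g : (ι → ℝ) → ℝ}
    (hg : Measurable g) (c : ℝ) :
    ∫ ω, g (fun i => X (u i) ω) * Real.exp (c * (X t ω - X s ω)) ∂P =
      (∫ ω, g (fun i => X (u i) ω) ∂P) * Real.exp (c ^ 2 * (t - s) / 2) := by
  have h := hX.integral_past_mul_cexp hst hu (g := fun v => (g v : ℂ)) (by fun_prop) c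
  rw [integral_complex_ofReal] at h
  rw [← Complex.ofReal_inj, ← integral_complex_ofReal]
  push_cast at h ⊢
  exact h

lemma aestronglyMeasurable_planarExp (hX : IsPreBrownianReal X P) (hY : IsPreBrownianReal Y P)
    (a b : ℝ) (t : ℝ≥0) : AEStronglyMeasurable (planarExp X Y a b t) P := by
  have h1 := hX.aemeasurable t
  have h2 := hY.aemeasurable t
  refine AEMeasurable.aestronglyMeasurable ?_
  unfold planarExp
  fun_prop

lemma integrable_planarExp (hX : IsPreBrownianReal X P) (hY : IsPreBrownianReal Y P)
    (a b : ℝ) (t : ℝ≥0) : Integrable (planarExp X Y a b t) P :=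
  (hX.integrable_exp_mul t a).mono' (aestronglyMeasurable_planarExp hX hY a b t)
    (ae_of_all _ fun ω => (norm_planarExp a b t ω).le)

/-- The `Y`-component of `planarExp` can be integrated out, even against a function of the path
of `X`. -/
lemma integral_past_mul_planarExp (hX : IsPreBrownianReal X P) (hY : IsPreBrownianReal Y P)
    (hXY : IndepFun (fun ω t => X t ω) (fun ω t => Y t ω) P) {ι : Type*} [Countable ι]
    (u : ι → ℝ≥0) {g : (ι → ℝ) → ℂ} (hg : Measurable g) (a b : ℝ) (t : ℝ≥0) :
    ∫ ω, g (fun i => X (u i) ω) * planarExp X Y a b t ω ∂P =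
      (∫ ω, g (fun i => X (u i) ω) * Complex.exp (a * X t ω) ∂P) *
        Complex.exp (-(b ^ 2 * t / 2)) := by
  have hind : IndepFun (fun ω => ((fun i => X (u i) ω), X t ω)) (fun ω => Y t ω) P :=
    hXY.comp (φ := fun f => ((fun i => f (u i)), f t)) (ψ := fun f => f t)
      (by fun_prop) (by fun_prop)
  have h := hind.integral_fun_comp_mul_comp
    (f := fun v : (ι → ℝ) × ℝ => g v.1 * Complex.exp (a * v.2))
    (g := fun y : ℝ => Complex.exp (b * Complex.I * y))
    ((aemeasurable_pi_lambda _ fun i => hX.aemeasurable _).prodMk (hX.aemeasurable _))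
    (hY.aemeasurable t) (Measurable.aestronglyMeasurable (by fun_prop)) (by fun_prop)
  simp only [planarExp, ← mul_assoc]
  rw [h, hY.integral_cexp_mul, mul_pow, Complex.I_sq]
  congr 2
  ring

lemma integral_planarExp (hX : IsPreBrownianReal X P) (hY : IsPreBrownianReal Y P)
    (hXY : IndepFun (fun ω t => X t ω) (fun ω t => Y t ω) P) {a b : ℝ} (hab : a ^ 2 = b ^ 2)
    (t : ℝ≥0) : ∫ ω, planarExp X Y a b t ω ∂P = 1 := by
  have h := integral_past_mul_planarExp hX hY hXY (ι := Empty) Empty.elim (g := fun _ => 1)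
    measurable_const a b t
  simp only [one_mul] at h
  rw [h, hX.integral_cexp_mul, ← Complex.exp_add, ← Complex.ofReal_pow, ← Complex.ofReal_pow, hab]
  simp

/-- The martingale property of `planarExp`, tested against events of the past of `X`. -/
lemma integral_past_mul_planarExp_eq (hX : IsPreBrownianReal X P) (hY : IsPreBrownianReal Y P)
    (hXY : IndepFun (fun ω t => X t ω) (fun ω t => Y t ω) P) {ι : Type*} [Countable ι]
    {u : ι → ℝ≥0} {i₀ : ι} (hu : ∀ i, u i ≤ u i₀) {t : ℝ≥0} (ht : u i₀ ≤ t) {g : (ι → ℝ) → ℂ}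
    (hg : Measurable g) {a b : ℝ} (hab : a ^ 2 = b ^ 2) :
    ∫ ω, g (fun i => X (u i) ω) * planarExp X Y a b t ω ∂P =
      ∫ ω, g (fun i => X (u i) ω) * planarExp X Y a b (u i₀) ω ∂P := by
  rw [integral_past_mul_planarExp hX hY hXY u hg, integral_past_mul_planarExp hX hY hXY u hg]
  have h := hX.integral_past_mul_cexp ht hu (g := fun v => g v * Complex.exp (a * v i₀))
    (by fun_prop) a
  have h' : (fun ω => g (fun i => X (u i) ω) * Complex.exp (a * X t ω)) =
      fun ω => g (fun i => X (u i) ω) * Complex.exp (a * X (u i₀) ω) *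
        Complex.exp (a * ((X t ω - X (u i₀) ω : ℝ) : ℂ)) := by
    funext ω
    rw [mul_assoc, ← Complex.exp_add]
    congr 2
    push_cast
    ring
  rw [h', h, mul_assoc, ← Complex.exp_add, ← Complex.ofReal_pow, ← Complex.ofReal_pow, hab]
  congr 2
  ring

/-- The submartingale property of `exp (c X)`, tested against events of the past of `X`. -/
lemma integral_past_mul_exp_le (hX : IsPreBrownianReal X P) {ι : Type*} [Countable ι]
    {u : ι → ℝ≥0} {i₀ : ι} (hu : ∀ i, u i ≤ u i₀) {t : ℝ≥0} (ht : u i₀ ≤ t) {g : (ι → ℝ) → ℝ}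
    (hg : Measurable g) (hg0 : ∀ v, 0 ≤ g v) (c : ℝ) :
    ∫ ω, g (fun i => X (u i) ω) * Real.exp (c * X (u i₀) ω) ∂P ≤
      ∫ ω, g (fun i => X (u i) ω) * Real.exp (c * X t ω) ∂P := by
  have h := hX.integral_past_mul_exp ht hu (g := fun v => g v * Real.exp (c * v i₀))
    (by fun_prop) c
  have h' : (fun ω => g (fun i => X (u i) ω) * Real.exp (c * X t ω)) =
      fun ω => g (fun i => X (u i) ω) * Real.exp (c * X (u i₀) ω) *
        Real.exp (c * (X t ω - X (u i₀) ω)) := by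
    funext ω
    rw [mul_assoc, ← Real.exp_add]
    congr 2
    ring
  rw [h', h]
  have ht' : (0 : ℝ) ≤ t - u i₀ := sub_nonneg.2 ht
  exact le_mul_of_one_le_right (integral_nonneg fun ω => mul_nonneg (hg0 _) (Real.exp_pos _).le)
    (Real.one_le_exp (by positivity))

/-! ### Optional stopping on a discrete set of times -/

section Grid
variable {E : Type*} [NormedAddCommGroup E] [NormedSpace ℝ E] {s : Set ℝ} {t : ℕ → ℝ≥0}

lemma aestronglyMeasurable_avoidIndicator (hX : ∀ t, AEMeasurable (X t) P) (hs : MeasurableSet s)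
    (t : ℕ → ℝ≥0) (k : ℕ) :
    AEStronglyMeasurable (fun ω => avoidIndicator s k fun j => X (t j) ω) P :=
  ((measurable_avoidIndicator hs k).comp_aemeasurable
    (aemeasurable_pi_lambda _ fun j => hX (t j))).aestronglyMeasurable

lemma integrable_avoidIndicator_smul (hX : ∀ t, AEMeasurable (X t) P) (hs : MeasurableSet s)
    (t : ℕ → ℝ≥0) (k : ℕ) {f : Ω → E} (hf : Integrable f P) :
    Integrable (fun ω => (avoidIndicator s k fun j => X (t j) ω) • f ω) P := by
  refine hf.mono ((aestronglyMeasurable_avoidIndicator hX hs t k).smul hf.1)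
    (ae_of_all _ fun ω => ?_)
  rw [norm_smul, Real.norm_of_nonneg (avoidIndicator_nonneg _ _ _)]
  exact mul_le_of_le_one_left (norm_nonneg _) (avoidIndicator_le_one _ _ _)

lemma aestronglyMeasurable_apply_cappedHittingTime_nat (hX : ∀ t, AEMeasurable (X t) P)
    (hs : MeasurableSet s) (t : ℕ → ℝ≥0) (K : ℕ) {Z : ℝ≥0 → Ω → E}
    (hZ : ∀ t, AEStronglyMeasurable (Z t) P) :
    AEStronglyMeasurable
      (fun ω => Z (t (cappedHittingTime (fun k => X (t k) ω) s K)) ω) P := by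
  simp only [apply_cappedHittingTime_eq]
  exact (hZ _).add (Finset.aestronglyMeasurable_fun_sum _ fun k _ =>
    (aestronglyMeasurable_avoidIndicator hX hs t k).smul ((hZ _).sub (hZ _)))

lemma integrable_apply_cappedHittingTime_nat (hX : ∀ t, AEMeasurable (X t) P)
    (hs : MeasurableSet s) (t : ℕ → ℝ≥0) (K : ℕ) {Z : ℝ≥0 → Ω → E}
    (hZ : ∀ t, Integrable (Z t) P) :
    Integrable (fun ω => Z (t (cappedHittingTime (fun k => X (t k) ω) s K)) ω) P := by
  simp only [apply_cappedHittingTime_eq]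
  exact (hZ _).add (integrable_finsetSum _ fun k _ =>
    integrable_avoidIndicator_smul hX hs t k ((hZ _).sub (hZ _)))

lemma integral_apply_cappedHittingTime_nat (hX : ∀ t, AEMeasurable (X t) P)
    (hs : MeasurableSet s) (t : ℕ → ℝ≥0) (K : ℕ) {Z : ℝ≥0 → Ω → E}
    (hZ : ∀ t, Integrable (Z t) P) :
    ∫ ω, Z (t (cappedHittingTime (fun k => X (t k) ω) s K)) ω ∂P = ∫ ω, Z (t 0) ω ∂P +
      ∑ k ∈ Finset.range K, ((∫ ω, (avoidIndicator s k fun j => X (t j) ω) • Z (t (k + 1)) ω ∂P) -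
        ∫ ω, (avoidIndicator s k fun j => X (t j) ω) • Z (t k) ω ∂P) := by
  have hsub (k : ℕ) : Integrable (fun ω =>
      (avoidIndicator s k fun j => X (t j) ω) • (Z (t (k + 1)) ω - Z (t k) ω)) P :=
    integrable_avoidIndicator_smul hX hs t k ((hZ _).sub (hZ _))
  simp only [apply_cappedHittingTime_eq]
  rw [integral_add (hZ _) (integrable_finsetSum _ fun k _ => hsub k),
    integral_finsetSum _ fun k _ => hsub k]
  congr 1
  refine Finset.sum_congr rfl fun k _ => ?_
  simp only [smul_sub]
  exact integral_sub (integrable_avoidIndicator_smul hX hs t k (hZ _))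
    (integrable_avoidIndicator_smul hX hs t k (hZ _))

-- In the next two lemmas the past up to index `k` is encoded as the sequence `j ↦ X (t (min j k))`,
-- whose times are all at most `t k`.

/-- Optional stopping for `planarExp` on a discrete set of times. -/
lemma integral_planarExp_cappedHittingTime_nat (hX : IsPreBrownianReal X P)
    (hY : IsPreBrownianReal Y P) (hXY : IndepFun (fun ω t => X t ω) (fun ω t => Y t ω) P)
    (hs : MeasurableSet s) (ht : Monotone t) (K : ℕ) {a b : ℝ} (hab : a ^ 2 = b ^ 2) :
    ∫ ω, planarExp X Y a b (t (cappedHittingTime (fun k => X (t k) ω) s K)) ω ∂P = 1 := by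
  rw [integral_apply_cappedHittingTime_nat hX.aemeasurable hs t K
    (integrable_planarExp hX hY a b), integral_planarExp hX hY hXY hab]
  refine add_eq_left.2 (Finset.sum_eq_zero fun k _ => sub_eq_zero.2 ?_)
  have h := integral_past_mul_planarExp_eq hX hY hXY (u := fun j => t (min j k)) (i₀ := k)
    (fun j => ht (by simp)) (t := t (k + 1)) (ht (by simp))
    (g := fun v => (avoidIndicator s k v : ℂ))
    (Complex.measurable_ofReal.comp (measurable_avoidIndicator hs k)) hab
  have hmin (ω : Ω) := avoidIndicator_min s k fun j => X (t j) ω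
  simpa only [hmin, min_self, Complex.real_smul] using h

/-- Exponential moments of Brownian motion only grow after a stopping time. With `c = 2 * a` this
bounds `planarExp` in `L²` at the hitting times along a grid, uniformly in the grid. -/
lemma integral_exp_cappedHittingTime_nat_le (hX : IsPreBrownianReal X P)
    (hs : MeasurableSet s) (ht : Monotone t) (K : ℕ) (c : ℝ) :
    ∫ ω, Real.exp (c * X (t (cappedHittingTime (fun k => X (t k) ω) s K)) ω) ∂P ≤
      ∫ ω, Real.exp (c * X (t K) ω) ∂P := by
  have hint (u : ℝ≥0) : Integrable (fun ω => Real.exp (c * X u ω)) P := hX.integrable_exp_mul u c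
  rw [integral_apply_cappedHittingTime_nat hX.aemeasurable hs t K
    (Z := fun u ω => Real.exp (c * X u ω)) hint]
  have htel := Finset.sum_range_sub (fun k => ∫ ω, Real.exp (c * X (t k) ω) ∂P) K
  rw [← sub_add_cancel (∫ ω, Real.exp (c * X (t K) ω) ∂P) (∫ ω, Real.exp (c * X (t 0) ω) ∂P),
    ← htel, add_comm _ (∫ ω, Real.exp (c * X (t 0) ω) ∂P)]
  refine add_le_add le_rfl (Finset.sum_le_sum fun k _ => ?_)
  have h := integral_past_mul_exp_le hX (u := fun j => t (min j k)) (i₀ := k)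
    (fun j => ht (by simp)) (t := t (k + 1)) (ht (by simp))
    (g := fun v => 1 - avoidIndicator s k v)
    (measurable_const.sub (measurable_avoidIndicator hs k))
    (fun v => sub_nonneg.2 (avoidIndicator_le_one _ _ _)) c
  have hmin (ω : Ω) := avoidIndicator_min s k fun j => X (t j) ω
  simp only [hmin, min_self, sub_mul, one_mul] at h
  have hA (l : ℕ) := integrable_avoidIndicator_smul hX.aemeasurable hs t k (hint (t l))
  simp only [smul_eq_mul] at hA ⊢
  rw [integral_sub (hint _) (hA _), integral_sub (hint _) (hA _)] at h
  linarith

end Grid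

/-! ### Optional stopping in continuous time -/

section Continuous
variable {E : Type*} [NormedAddCommGroup E] [NormedSpace ℝ E] {s : Set ℝ}

lemma aestronglyMeasurable_apply_cappedHittingTime_of_isOpen (hX : ∀ t, AEMeasurable (X t) P)
    (hXc : ∀ᵐ ω ∂P, Continuous (X · ω)) (hs : IsOpen s) (N : ℕ) {Z : ℝ≥0 → Ω → E}
    (hZ : ∀ t, AEStronglyMeasurable (Z t) P) (hZc : ∀ᵐ ω ∂P, Continuous (Z · ω)) :
    AEStronglyMeasurable (fun ω => Z (cappedHittingTime (X · ω) s N) ω) P := by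
  refine aestronglyMeasurable_of_tendsto_ae atTop
    (fun n => aestronglyMeasurable_apply_cappedHittingTime_nat hX hs.measurableSet
      (gridTime n) (N * (n + 1)) hZ) ?_
  filter_upwards [hXc, hZc] with ω h1 h2
  exact tendsto_apply_gridTime_cappedHittingTime hs N h1 h2

lemma isOpen_lt_abs (r : ℝ) : IsOpen {y : ℝ | r < |y|} := isOpen_lt continuous_const continuous_abs

lemma aestronglyMeasurable_apply_cappedHittingTime (hX : ∀ t, AEMeasurable (X t) P)
    (hXc : ∀ᵐ ω ∂P, Continuous (X · ω)) (N : ℕ) {Z : ℝ≥0 → Ω → E}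
    (hZ : ∀ t, AEStronglyMeasurable (Z t) P) (hZc : ∀ᵐ ω ∂P, Continuous (Z · ω)) :
    AEStronglyMeasurable (fun ω => Z (cappedHittingTime (X · ω) {y | 1 ≤ |y|} N) ω) P := by
  refine aestronglyMeasurable_of_tendsto_ae atTop
    (fun m : ℕ => aestronglyMeasurable_apply_cappedHittingTime_of_isOpen hX hXc
      (isOpen_lt_abs (1 - 1 / ((m : ℝ) + 1))) N hZ hZc) ?_
  filter_upwards [hXc, hZc] with ω h1 h2
  exact tendsto_apply_cappedHittingTime_one N h1 h2

/-- Optional stopping for `planarExp` at the exit time from `[-r, r]`, as the limit of optional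
stopping along grids. The overshoot on the grids is controlled in `L²`. -/
lemma integral_planarExp_cappedHittingTime_lt (hX : IsBrownianReal X P) (hY : IsBrownianReal Y P)
    (hXY : IndepFun (fun ω t => X t ω) (fun ω t => Y t ω) P) {r : ℝ} (hr : 0 ≤ r) (N : ℕ)
    {a b : ℝ} (hab : a ^ 2 = b ^ 2) :
    ∫ ω, planarExp X Y a b (cappedHittingTime (X · ω) {y | r < |y|} N) ω ∂P = 1 := by
  have := hX.isGaussianProcess.isProbabilityMeasure
  have hX' := hX.toIsPreBrownianReal
  have hY' := hY.toIsPreBrownianReal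
  have hs := (isOpen_lt_abs r).measurableSet
  have hsq (u : ℝ≥0) (ω : Ω) : ‖planarExp X Y a b u ω‖ ^ 2 = Real.exp (2 * a * X u ω) := by
    rw [norm_planarExp, ← Real.exp_nat_mul]
    congr 1
    push_cast
    ring
  refine tendsto_nhds_unique (tendsto_integral_of_integral_sq_le
    (C := ∫ ω, Real.exp (2 * a * X N ω) ∂P) (f := fun n ω => planarExp X Y a b
      (gridTime n
        (cappedHittingTime (fun k => X (gridTime n k) ω) {y | r < |y|} (N * (n + 1)))) ω)
    (fun n => ?_) (fun n => ?_) ?_ ?_) ?_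
  · rw [memLp_two_iff_integrable_sq_norm (aestronglyMeasurable_apply_cappedHittingTime_nat
      hX'.aemeasurable hs (gridTime n) _ (aestronglyMeasurable_planarExp hX' hY' a b))]
    simp only [hsq]
    exact integrable_apply_cappedHittingTime_nat hX'.aemeasurable hs (gridTime n) _
      (Z := fun u ω => Real.exp (2 * a * X u ω)) fun u => hX'.integrable_exp_mul u _
  · simp only [hsq]
    rw [← gridTime_mul_succ n N]
    exact integral_exp_cappedHittingTime_nat_le hX' hs (monotone_gridTime n) _ _
  · refine Integrable.of_bound (C := Real.exp (|a| * r))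
      (aestronglyMeasurable_apply_cappedHittingTime_of_isOpen hX'.aemeasurable hX.cont
        (isOpen_lt_abs r) N (aestronglyMeasurable_planarExp hX' hY' a b) ?_) ?_
    · filter_upwards [hX.cont, hY.cont] with ω h1 h2 using continuous_planarExp a b h1 h2
    · filter_upwards [hX.cont, hX'.eval_zero_ae_eq_zero] with ω h1 h0
      exact norm_planarExp_le (abs_cappedHittingTime_le h1 (by simpa [h0] using hr)
        (fun y hy => not_lt.1 hy) _)
  · filter_upwards [hX.cont, hY.cont] with ω h1 h2
    exact tendsto_apply_gridTime_cappedHittingTime (isOpen_lt_abs r) N h1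
      (continuous_planarExp a b h1 h2)
  · simp only [integral_planarExp_cappedHittingTime_nat hX' hY' hXY hs (monotone_gridTime _) _ hab]
    exact tendsto_const_nhds

/-- Optional stopping for `planarExp` at the exit time from `(-1, 1)`, capped at `N`. -/
lemma integral_planarExp_cappedHittingTime (hX : IsBrownianReal X P) (hY : IsBrownianReal Y P)
    (hXY : IndepFun (fun ω t => X t ω) (fun ω t => Y t ω) P) (N : ℕ) {a b : ℝ}
    (hab : a ^ 2 = b ^ 2) :
    ∫ ω, planarExp X Y a b (cappedHittingTime (X · ω) {y | 1 ≤ |y|} N) ω ∂P = 1 := by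
  have := hX.isGaussianProcess.isProbabilityMeasure
  have hX' := hX.toIsPreBrownianReal
  have hY' := hY.toIsPreBrownianReal
  have hr0 (m : ℕ) : 0 ≤ 1 - 1 / ((m : ℝ) + 1) := by
    rw [sub_nonneg, div_le_one (by positivity)]
    simp
  have hr1 (m : ℕ) : 1 - 1 / ((m : ℝ) + 1) ≤ 1 := sub_le_self _ (by positivity)
  refine tendsto_nhds_unique (tendsto_integral_of_dominated_convergence
    (F := fun (m : ℕ) ω => planarExp X Y a b
      (cappedHittingTime (X · ω) {y | 1 - 1 / ((m : ℝ) + 1) < |y|} N) ω)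
    (fun _ => Real.exp (|a| * 1)) (fun m => ?_) (integrable_const _) (fun m => ?_) ?_) ?_
  · refine aestronglyMeasurable_apply_cappedHittingTime_of_isOpen hX'.aemeasurable hX.cont
      (isOpen_lt_abs _) N (aestronglyMeasurable_planarExp hX' hY' a b) ?_
    filter_upwards [hX.cont, hY.cont] with ω h1 h2 using continuous_planarExp a b h1 h2
  · filter_upwards [hX.cont, hX'.eval_zero_ae_eq_zero] with ω h1 h0
    exact norm_planarExp_le (abs_cappedHittingTime_le h1 (by simp [h0])
      (fun y hy => (not_lt.1 hy).trans (hr1 m)) _)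
  · filter_upwards [hX.cont, hY.cont] with ω h1 h2
    exact tendsto_apply_cappedHittingTime_one N h1 (continuous_planarExp a b h1 h2)
  · simp only [integral_planarExp_cappedHittingTime_lt hX hY hXY (hr0 _) N hab]
    exact tendsto_const_nhds

/-- Brownian motion leaves `(-1, 1)`: at time `n` it lies there with probability at most
`2 / √(2πn)`. -/
lemma ae_nonempty_preimage_one_le_abs (hX : IsPreBrownianReal X P) :
    ∀ᵐ ω ∂P, ((X · ω) ⁻¹' {y | 1 ≤ |y|}).Nonempty := by
  have hbound (n : ℕ) : P {ω | ¬((X · ω) ⁻¹' {y | 1 ≤ |y|}).Nonempty} ≤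
      ENNReal.ofReal ((√(2 * Real.pi * (n + 1)))⁻¹) * 2 := by
    calc P {ω | ¬((X · ω) ⁻¹' {y | 1 ≤ |y|}).Nonempty}
        ≤ P {ω | X ((n + 1 : ℕ) : ℝ≥0) ω ∈ Set.Ioo (-1) 1} := by
          refine measure_mono fun ω hω => ?_
          have h := Set.not_nonempty_iff_eq_empty.1 hω
          have h' : ((n + 1 : ℕ) : ℝ≥0) ∉ (X · ω) ⁻¹' {y | 1 ≤ |y|} := by simp [h]
          exact abs_lt.1 (not_le.1 h')
      _ = gaussianReal 0 ((n + 1 : ℕ) : ℝ≥0) (Set.Ioo (-1) 1) :=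
          (hX.hasLaw_eval _).measure_eq measurableSet_Ioo
      _ = ∫⁻ y in Set.Ioo (-1) 1, gaussianPDF 0 ((n + 1 : ℕ) : ℝ≥0) y :=
          gaussianReal_apply _ (by positivity) _
      _ ≤ ∫⁻ _ in Set.Ioo (-1 : ℝ) 1, ENNReal.ofReal ((√(2 * Real.pi * (n + 1)))⁻¹) := by
          refine lintegral_mono fun y => ENNReal.ofReal_le_ofReal ?_
          rw [gaussianPDFReal]
          push_cast
          refine mul_le_of_le_one_right (by positivity) (Real.exp_le_one_iff.2 ?_)
          rw [neg_div]
          exact neg_nonpos.2 (by positivity)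
      _ = ENNReal.ofReal ((√(2 * Real.pi * (n + 1)))⁻¹) * 2 := by
          rw [setLIntegral_const, Real.volume_Ioo]
          norm_num
  have hlim : Tendsto (fun n : ℕ => ENNReal.ofReal ((√(2 * Real.pi * (n + 1)))⁻¹) * 2) atTop
      (𝓝 0) := by
    have h1 : Tendsto (fun n : ℕ => 2 * Real.pi * ((n : ℝ) + 1)) atTop atTop :=
      (tendsto_atTop_add_const_right _ _ tendsto_natCast_atTop_atTop).const_mul_atTop
        (by positivity)
    have h2 := (ENNReal.tendsto_ofReal
      (tendsto_inv_atTop_zero.comp (Real.tendsto_sqrt_atTop.comp h1)))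
    simpa using ENNReal.Tendsto.mul_const h2 (b := 2) (Or.inr (by simp))
  exact le_antisymm (ge_of_tendsto' hlim hbound) zero_le

/-- On almost every path `X` leaves `(-1, 1)` through `±1`, and deadlines beyond the exit time do
not matter. The exit time is written as an infimum in `ℝ≥0`, which has the junk value `0` only on
the null set of paths that stay in `(-1, 1)`. -/
lemma ae_exists_exit (hX : IsBrownianReal X P) :
    ∀ᵐ ω ∂P, |X (sInf ((X · ω) ⁻¹' {y | 1 ≤ |y|})) ω| = 1 ∧ ∀ᶠ N : ℕ in atTop,
      cappedHittingTime (X · ω) {y | 1 ≤ |y|} N = sInf ((X · ω) ⁻¹' {y | 1 ≤ |y|}) := by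
  filter_upwards [hX.cont, hX.eval_zero_ae_eq_zero,
    ae_nonempty_preimage_one_le_abs hX.toIsPreBrownianReal] with ω h1 h0 h
  exact exists_exit h1 (by simp [h0]) h

lemma aestronglyMeasurable_apply_exit (hX : IsBrownianReal X P) {Z : ℝ≥0 → Ω → E}
    (hZ : ∀ t, AEStronglyMeasurable (Z t) P) (hZc : ∀ᵐ ω ∂P, Continuous (Z · ω)) :
    AEStronglyMeasurable (fun ω => Z (sInf ((X · ω) ⁻¹' {y | 1 ≤ |y|})) ω) P := by
  refine aestronglyMeasurable_of_tendsto_ae atTop (fun N : ℕ =>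
    aestronglyMeasurable_apply_cappedHittingTime hX.aemeasurable hX.cont N hZ hZc) ?_
  filter_upwards [ae_exists_exit hX] with ω h
  exact tendsto_nhds_of_eventually_eq (h.2.mono fun N hN => by rw [hN])

/-- Optional stopping for `planarExp` at the exit time from `(-1, 1)`. -/
lemma integral_planarExp_exit (hX : IsBrownianReal X P) (hY : IsBrownianReal Y P)
    (hXY : IndepFun (fun ω t => X t ω) (fun ω t => Y t ω) P) {a b : ℝ} (hab : a ^ 2 = b ^ 2) :
    ∫ ω, planarExp X Y a b (sInf ((X · ω) ⁻¹' {y | 1 ≤ |y|})) ω ∂P = 1 := by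
  have := hX.isGaussianProcess.isProbabilityMeasure
  have hX' := hX.toIsPreBrownianReal
  refine tendsto_nhds_unique (tendsto_integral_of_dominated_convergence
    (F := fun (N : ℕ) ω => planarExp X Y a b (cappedHittingTime (X · ω) {y | 1 ≤ |y|} N) ω)
    (fun _ => Real.exp (|a| * 1)) (fun N => ?_) (integrable_const _) (fun N => ?_) ?_) ?_
  · refine aestronglyMeasurable_apply_cappedHittingTime hX'.aemeasurable hX.cont N
      (aestronglyMeasurable_planarExp hX' hY.toIsPreBrownianReal a b) ?_
    filter_upwards [hX.cont, hY.cont] with ω h1 h2 using continuous_planarExp a b h1 h2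
  · filter_upwards [hX.cont, hX'.eval_zero_ae_eq_zero] with ω h1 h0
    exact norm_planarExp_le (abs_cappedHittingTime_le h1 (by simp [h0])
      (fun y hy => (not_le.1 hy).le) _)
  · filter_upwards [ae_exists_exit hX] with ω h
    exact tendsto_nhds_of_eventually_eq (h.2.mono fun N hN => by rw [hN])
  · simp only [integral_planarExp_cappedHittingTime hX hY hXY _ hab]
    exact tendsto_const_nhds

/-- The characteristic function of `Y` at the exit time of `X` from `(-1, 1)`. Averaging over
`a = ± b` in `integral_planarExp_exit` replaces `exp (a X)` by `cosh (b X)`, which is constant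
on `{-1, 1}`. -/
lemma integral_cexp_exit (hX : IsBrownianReal X P) (hY : IsBrownianReal Y P)
    (hXY : IndepFun (fun ω t => X t ω) (fun ω t => Y t ω) P) (b : ℝ) :
    ∫ ω, Complex.exp (b * Complex.I * Y (sInf ((X · ω) ⁻¹' {y | 1 ≤ |y|})) ω) ∂P =
      1 / Real.cosh b := by
  have := hX.isGaussianProcess.isProbabilityMeasure
  have hX' := hX.toIsPreBrownianReal
  have hint (a : ℝ) : Integrable
      (fun ω => planarExp X Y a b (sInf ((X · ω) ⁻¹' {y | 1 ≤ |y|})) ω) P := by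
    refine Integrable.of_bound (C := Real.exp (|a| * 1)) (aestronglyMeasurable_apply_exit hX
      (aestronglyMeasurable_planarExp hX' hY.toIsPreBrownianReal a b) ?_) ?_
    · filter_upwards [hX.cont, hY.cont] with ω h1 h2 using continuous_planarExp a b h1 h2
    · filter_upwards [ae_exists_exit hX] with ω h using norm_planarExp_le h.1.le
  have h := integral_add (hint b) (hint (-b))
  rw [integral_planarExp_exit hX hY hXY rfl, integral_planarExp_exit hX hY hXY (by ring)] at h
  have hcosh : (Real.cosh b : ℂ) ≠ 0 := by exact_mod_cast (Real.cosh_pos b).ne'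
  have h2 : ∫ ω, (2 * Real.cosh b : ℂ) *
      Complex.exp (b * Complex.I * Y (sInf ((X · ω) ⁻¹' {y | 1 ≤ |y|})) ω) ∂P = 1 + 1 := by
    rw [← h]
    refine integral_congr_ae ?_
    filter_upwards [ae_exists_exit hX] with ω hω
    have hc : Real.cosh b = Real.cosh (b * X (sInf ((X · ω) ⁻¹' {y | 1 ≤ |y|})) ω) := by
      rw [← Real.cosh_abs b, ← Real.cosh_abs (b * _), abs_mul, hω.1, mul_one]
    rw [hc, planarExp, planarExp, ← add_mul]
    congr 1
    push_cast
    rw [Complex.two_cosh, neg_mul]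
  rw [integral_const_mul] at h2
  rw [eq_div_iff hcosh]
  linear_combination h2 / 2

end Continuous

end Processes

/-! ### The exit from the strip -/

lemma mem_compl_verticalStrip_iff (z : ℂ) : z ∈ verticalStripᶜ ↔ 1 ≤ |z.re| := by
  rw [← not_iff_not, not_le, abs_lt, Set.mem_compl_iff, not_not]
  rfl

lemma exitTime_verticalStrip_eq {Ω : Type*} {B : ℝ≥0 → Ω → ℂ} {ω : Ω}
    (h : ((fun t => (B t ω).re) ⁻¹' {y | 1 ≤ |y|}).Nonempty) :
    exitTime B verticalStrip ω = (sInf ((fun t => (B t ω).re) ⁻¹' {y | 1 ≤ |y|}) : ℝ≥0) := by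
  have hset : {i : ℝ≥0 | 0 ≤ i ∧ B i ω ∈ verticalStripᶜ} =
      (fun t => (B t ω).re) ⁻¹' {y | 1 ≤ |y|} := by
    ext i
    exact (and_iff_right zero_le).trans (mem_compl_verticalStrip_iff _)
  obtain ⟨t, ht⟩ := h
  rw [exitTime, hittingAfter, if_pos ⟨t, zero_le, (mem_compl_verticalStrip_iff _).2 ht⟩, hset]

theorem mainTheorem2 {Ω : Type*} [MeasurableSpace Ω] (P : Measure Ω) [IsProbabilityMeasure P]
    (B : ℝ≥0 → Ω → ℂ) (hB : IsComplexBrownian B 0 P) :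
    (∀ᵐ ω ∂P, exitTime B verticalStrip ω ≠ ⊤) ∧
      HasLaw (fun ω => (stoppedValue B (exitTime B verticalStrip) ω).im)
        hyperbolicSecantLaw P := by
  obtain ⟨hX, hY, hXY⟩ := hB
  simp only [Complex.zero_re, Complex.zero_im, sub_zero] at hX hY hXY
  have hexit := ae_nonempty_preimage_one_le_abs hX.toIsPreBrownianReal
  refine ⟨hexit.mono fun ω h => ?_, ?_⟩
  · rw [exitTime_verticalStrip_eq h]
    exact WithTop.coe_ne_top
  have hmeas : AEMeasurable
      (fun ω => (B (sInf ((fun t => (B t ω).re) ⁻¹' {y | 1 ≤ |y|})) ω).im) P :=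
    (aestronglyMeasurable_apply_exit hX (Z := fun t ω => (B t ω).im)
      (fun t => (hY.aemeasurable t).aestronglyMeasurable) hY.cont).aemeasurable
  have hlaw : HasLaw (fun ω => (B (sInf ((fun t => (B t ω).re) ⁻¹' {y | 1 ≤ |y|})) ω).im)
      hyperbolicSecantLaw P := by
    refine ⟨hmeas, ?_⟩
    have := Measure.isProbabilityMeasure_map hmeas
    refine Measure.ext_of_charFun (funext fun b => ?_)
    rw [charFun_hyperbolicSecantLaw, ← integral_cexp_exit hX hY hXY b, charFun_apply_real,
      integral_map hmeas (by fun_prop)]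
    simp only [mul_right_comm]
  refine hlaw.congr (hexit.mono fun ω h => ?_)
  simp only [stoppedValue, exitTime_verticalStrip_eq h]
  rfl
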